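/- **Setting.** For $n\in\mathbb N=\{1,2,\dots\}$ let $(X_n,d_n)$ be a proper length space (closed balls are compact, and the distance of two points is the infimum of the lengths of curves joining them), $p_n\in X_n$, and $m_n$ a Radon measure on the Borel sets of $X_n$; assume that infinitely many of the $X_n$ have more than one point. Let $(X_\infty,d_\infty)$ be a complete metric space and $p_\infty\in X_\infty$. Write $B_n(x,r)$, $B_\infty(x,r)$ for open balls and $\overline{B_n(x,r)}$ for closed balls. Let $V_n$ ($n\in\mathbb N$), $V_\infty$, $V_l$, $V_u$ be (weakly) increasing functions $(0,\infty)\to(0,\infty)$, and let $\alpha,\alpha'>0$, $C_{\mathrm v}\ge 1$. Assume: * (A4) for all $0<r\le R<\infty$ and $j\in\mathbb N\cup\{u,l\}$, $$C_{\mathrm v}^{-1}\Big(\frac Rr\Big)^{\alpha}\le\frac{V_j(R)}{V_j(r)}\le C_{\mathrm v}\Big(\frac Rr\Big)^{\alpha'};$$ for all $n\in\mathbb N$, $x\in X_n$ and $0<r<\operatorname{diam}(X_n,d_n)\in[0,\infty]$, $$C_{\mathrm v}^{-1}V_n(r)\le m_n(B_n(x,r))\le C_{\mathrm v}V_n(r);$$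 and $C_{\mathrm v}^{-1}V_l(r)\le V_j(r)\le C_{\mathrm v}V_u(r)$ for all $r>0$ and $j\in\mathbb N\cup\{\infty\}$. * (A5) $V_n\to V_\infty$ uniformly on compact subsets of $(0,\infty)$. * (A6) $(X_n,d_n,p_n)\to(X_\infty,d_\infty,p_\infty)$ in the pointed Gromov–Hausdorff sense: for all $0<\epsilon<r$ there is $i_0$ such that for each $i\ge i_0$ there is a map $f:B_i(p_i,r)\to X_\infty$ with $f(p_i)=p_\infty$, with $|d_\infty(f(x),f(y))-d_i(x,y)|<\epsilon$ for all $x,y\in B_i(p_i,r)$, and such that $B_\infty(p_\infty,r-\epsilon)$ is contained in the open $\epsilon$-neighbourhood of $f(B_i(p_i,r))$. A *family of approximate isometries* consists of positive numbers $\epsilon_n\downarrow0$ and $R_n\uparrow\infty$ (weakly monotone) and maps $f_n:\overline{B_n(p_n,R_n)}\to B_\infty(p_\infty,R_n)$, $n\in\mathbb N$, such that each $f_n$ is measurable with respect to the $m_n$-completion of the Borel $\sigma$-algebra of $\overline{B_n(p_n,R_n)}$; the image of $f_n$ is finite and every point of $B_\infty(p_\infty,R_n)$ is within distance $2\epsilon_n$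 of it; $|d_\infty(f_n(x),f_n(y))-d_n(x,y)|\le\epsilon_n$ for all $x,y\in\overline{B_n(p_n,R_n)}$; and $f_n(p_n)=p_\infty$. **Claim.** Families of approximate isometries exist, and for every such family $(\epsilon_n,R_n,f_n)_{n}$ there is a Radon measure $m_\infty$ on the Borel sets of $X_\infty$ such that: 1. there is a constant $C\ge1$ with $$C^{-1}V_\infty(r)\le m_\infty(B_\infty(x,r))\le C\,V_\infty(r)\qquad\text{for all }x\in X_\infty,\ 0<r<\operatorname{diam}(X_\infty,d_\infty);$$ 2. there is a subsequence $n_1<n_2<\cdots$ such that for every $R\in(\mathbb Q\cap(0,\infty))\cup\{R_n:n\in\mathbb N\}$ and every bounded, uniformly continuous $\phi:B_\infty(p_\infty,R)\to\mathbb R$, $$\int_{B_\infty(p_\infty,R)}\phi\,\mathrm d\,(f_{n_i})_{\#}\big(m_{n_i}|_{\overline{B_{n_i}(p_{n_i},R_{n_i})}}\big)\ \longrightarrow\ \int_{B_\infty(p_\infty,R)}\phi\,\mathrm dm_\infty\qquad(i\to\infty).$$ -/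

import Mathlib

open Set Filter Topology MeasureTheory
open scoped ENNReal

/-- A metric space is a length space if the distance between any two points is the infimum of the
lengths of the (continuous) curves joining them. The length of a curve is its total variation; it
may be infinite, and the infimum over the empty family is `∞`. -/
def IsLengthSpace (X : Type*) [MetricSpace X] : Prop :=
  ∀ x y : X, edist x y = ⨅ γ : Path x y, eVariationOn γ univ

/-- Pointed Gromov–Hausdorff convergence of `(X n, p n)` to `(Y, q)`. The approximation `f` only
matters on the open ball `B(p n, r)`. -/
def PointedGHTendsto (X : ℕ → Type*) [∀ n, MetricSpace (X n)] (p : ∀ n, X n)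
    (Y : Type*) [MetricSpace Y] (q : Y) : Prop :=
  ∀ r ε : ℝ, 0 < ε → ε < r → ∃ i₀ : ℕ, ∀ i ≥ i₀, ∃ f : X i → Y,
    f (p i) = q ∧
    (∀ x ∈ Metric.ball (p i) r, ∀ y ∈ Metric.ball (p i) r,
      |dist (f x) (f y) - dist x y| < ε) ∧
    Metric.ball q (r - ε) ⊆ Metric.thickening ε (f '' Metric.ball (p i) r)

/-- A function `(0,∞) → (0,∞)` that is increasing (values at non-positive arguments are
irrelevant). -/
structure IsVolumeGauge (V : ℝ → ℝ) : Prop where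
  pos : ∀ r, 0 < r → 0 < V r
  mono : ∀ r s, 0 < r → r ≤ s → V r ≤ V s

/-- `C⁻¹ (R/r)^α ≤ V(R)/V(r) ≤ C (R/r)^α'` for all `0 < r ≤ R`. -/
def HasPowerGrowth (V : ℝ → ℝ) (C α α' : ℝ) : Prop :=
  ∀ r R : ℝ, 0 < r → r ≤ R →
    C⁻¹ * (R / r) ^ α ≤ V R / V r ∧ V R / V r ≤ C * (R / r) ^ α'

/-- `C⁻¹ V(r) ≤ μ(B(x,r)) ≤ C V(r)` for all `x` and all `0 < r < diam X`, where the diameter may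
be infinite. -/
def HasVolumeGrowth {X : Type*} [MetricSpace X] [MeasurableSpace X] (μ : Measure X)
    (V : ℝ → ℝ) (C : ℝ) : Prop :=
  ∀ (x : X) (r : ℝ), 0 < r → ENNReal.ofReal r < Metric.ediam (univ : Set X) →
    ENNReal.ofReal (C⁻¹ * V r) ≤ μ (Metric.ball x r) ∧
    μ (Metric.ball x r) ≤ ENNReal.ofReal (C * V r)

/-- The uniform volume assumption on the spaces `(X n, m n)`, with volume functions `V n`, limit
volume function `Vinf`, comparison functions `Vl`, `Vu` and constants `C`, `α`, `α'`. -/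
structure UniformVolumeAssumption (X : ℕ → Type*) [∀ n, MetricSpace (X n)]
    [∀ n, MeasurableSpace (X n)] (m : ∀ n, Measure (X n))
    (V : ℕ → ℝ → ℝ) (Vinf Vl Vu : ℝ → ℝ) (C α α' : ℝ) : Prop where
  one_le_C : 1 ≤ C
  alpha_pos : 0 < α
  alpha'_pos : 0 < α'
  gauge : ∀ n, IsVolumeGauge (V n)
  gauge_inf : IsVolumeGauge Vinf
  gauge_l : IsVolumeGauge Vl
  gauge_u : IsVolumeGauge Vu
  growth : ∀ n, HasPowerGrowth (V n) C α α'
  growth_l : HasPowerGrowth Vl C α α'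
  growth_u : HasPowerGrowth Vu C α α'
  volume : ∀ n, HasVolumeGrowth (m n) (V n) C
  bounds : ∀ n r, 0 < r → C⁻¹ * Vl r ≤ V n r ∧ V n r ≤ C * Vu r
  bounds_inf : ∀ r, 0 < r → C⁻¹ * Vl r ≤ Vinf r ∧ Vinf r ≤ C * Vu r

/-- `V n → Vinf` uniformly on compact subsets of `(0,∞)`. Under `UniformVolumeAssumption` this is
the same as uniform convergence on compact subsets of `[0,∞)` after extending all functions by `0`
at `0`, because then `V n r ≤ C r ^ α V n 1` for `r ≤ 1`. -/
def VolumeTendsto (V : ℕ → ℝ → ℝ) (Vinf : ℝ → ℝ) : Prop :=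
  ∀ K : Set ℝ, K ⊆ Ioi 0 → IsCompact K → TendstoUniformlyOn V Vinf atTop K

/-- A family of (measurable, finitely valued) `ε n`-approximate isometries
`f n : closedBall (p n) (R n) → ball q (R n)`. Values of `f n` outside the closed ball are
irrelevant. Measurability with respect to the `m n`-completion of the Borel σ-algebra of the closed
ball is expressed as a.e.-measurability for the restricted measure. -/
structure IsApproxIsometryFamily (X : ℕ → Type*) [∀ n, MetricSpace (X n)]
    [∀ n, MeasurableSpace (X n)] (m : ∀ n, Measure (X n)) (p : ∀ n, X n)
    (Y : Type*) [MetricSpace Y] [MeasurableSpace Y] (q : Y)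
    (ε R : ℕ → ℝ) (f : ∀ n, X n → Y) : Prop where
  eps_pos : ∀ n, 0 < ε n
  eps_antitone : Antitone ε
  eps_tendsto : Tendsto ε atTop (𝓝 0)
  R_pos : ∀ n, 0 < R n
  R_monotone : Monotone R
  R_tendsto : Tendsto R atTop atTop
  mapsTo : ∀ n, MapsTo (f n) (Metric.closedBall (p n) (R n)) (Metric.ball q (R n))
  aemeasurable : ∀ n, AEMeasurable (f n) ((m n).restrict (Metric.closedBall (p n) (R n)))
  finite_image : ∀ n, (f n '' Metric.closedBall (p n) (R n)).Finite
  net : ∀ n, ∀ y ∈ Metric.ball q (R n), ∃ x ∈ Metric.closedBall (p n) (R n),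
    dist y (f n x) ≤ 2 * ε n
  distortion : ∀ n, ∀ x ∈ Metric.closedBall (p n) (R n), ∀ y ∈ Metric.closedBall (p n) (R n),
    |dist (f n x) (f n y) - dist x y| ≤ ε n
  basepoint : ∀ n, f n (p n) = q

/-- Weak convergence on a set `B`: `∫_B φ dμ_k → ∫_B φ dμ` for every bounded, uniformly continuous
`φ` on `B` (values of `φ` outside `B` are irrelevant). -/
def TendstoWeaklyOn {Y : Type*} [MetricSpace Y] [MeasurableSpace Y] (μs : ℕ → Measure Y)
    (μ : Measure Y) (B : Set Y) : Prop :=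
  ∀ φ : Y → ℝ, UniformContinuousOn φ B → (∃ M : ℝ, ∀ y ∈ B, |φ y| ≤ M) →
    Tendsto (fun k => ∫ y in B, φ y ∂(μs k)) atTop (𝓝 (∫ y in B, φ y ∂μ))

/-! Existence of families. In a length space a point can be moved towards the base point by a
prescribed amount at almost exactly that cost (`IsLengthSpace.exists_dist_eq`). A Gromov–Hausdorff
approximation of a slightly larger ball, precomposed with a finitely valued map that pushes points
slightly inwards, therefore sends a closed ball into the open ball of the same radius. Accuracy and
radius then improve slowly with `n`.

Limit measure. The finite images of the `f n` are nets, so the complete limit space is proper. The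
volume bounds make the push-forwards uniformly bounded on balls, and separability together with
Riesz representation yields a vaguely convergent subsequence (`exists_subseq_tendsto_integral`).
Testing against tent functions carries the volume growth to the limit, since `f n` distorts balls
only by multiples of `ε n`.

Weak convergence on a ball further requires that no mass collects at its boundary sphere. By the
length property and doubling, a thin annulus is dominated by a disjoint one just inside it; both lie
in an annulus nine times as thick, so the measure decays geometrically with the thickness, uniformly
in `n` (`HasVolumeGrowth.annulus_le_pow`). Hence no radius is exceptional. -/

/-! ### Moving points in length spaces -/

/-- In a length space, almost shortest curves from `x` to `p` meet every intermediate sphere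
around `p`. -/
theorem IsLengthSpace.exists_dist_eq {X : Type*} [MetricSpace X] (hX : IsLengthSpace X)
    (x p : X) {t η : ℝ} (ht : 0 ≤ t) (htx : t ≤ dist x p) (hη : 0 < η) :
    ∃ z, dist z p = t ∧ dist x z ≤ dist x p - t + η := by
  have h1 : (⨅ γ : Path x p, eVariationOn γ univ) < ENNReal.ofReal (dist x p + η) := by
    rw [← hX x p, edist_dist]
    exact (ENNReal.ofReal_lt_ofReal_iff (by positivity)).2 (by linarith)
  obtain ⟨γ, hγ⟩ := iInf_lt_iff.1 h1
  have hc : Continuous fun s => dist (γ s) p := by fun_prop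
  obtain ⟨s, hs⟩ : t ∈ range fun s => dist (γ s) p :=
    mem_range_of_exists_le_of_exists_ge hc ⟨1, by simpa using ht⟩ ⟨0, by simpa using htx⟩
  refine ⟨γ s, hs, ?_⟩
  have h2 := eVariationOn.Icc_add_Icc γ (s := univ) (a := 0) (b := s) (c := 1)
    s.2.1 s.2.2 (mem_univ _)
  have h3 : edist (γ 0) (γ s) ≤ eVariationOn γ (univ ∩ Icc 0 s) :=
    eVariationOn.edist_le _ ⟨mem_univ _, le_rfl, s.2.1⟩ ⟨mem_univ _, s.2.1, le_rfl⟩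
  have h4 : edist (γ s) (γ 1) ≤ eVariationOn γ (univ ∩ Icc s 1) :=
    eVariationOn.edist_le _ ⟨mem_univ _, le_rfl, s.2.2⟩ ⟨mem_univ _, s.2.2, le_rfl⟩
  have h5 : edist x (γ s) + edist (γ s) p < ENNReal.ofReal (dist x p + η) := by
    refine lt_of_le_of_lt ?_ hγ
    simp only [γ.source, γ.target] at h3 h4
    exact (add_le_add h3 h4).trans (h2.le.trans (eVariationOn.mono _ inter_subset_left))
  rw [edist_dist, edist_dist, ← ENNReal.ofReal_add dist_nonneg dist_nonneg,
    ENNReal.ofReal_lt_ofReal_iff (by positivity)] at h5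
  simp only at hs
  linarith

/-- Every point of a length space close to the ball `closedBall p ρ` can be moved into it at
small cost. -/
theorem IsLengthSpace.exists_retract {X : Type*} [MetricSpace X] (hX : IsLengthSpace X)
    (x p : X) {ρ s η : ℝ} (hρ : 0 ≤ ρ) (hx : dist x p ≤ ρ + s) (hs : 0 ≤ s) (hη : 0 < η) :
    ∃ z, dist z p ≤ ρ ∧ dist x z ≤ s + η := by
  by_cases h : dist x p ≤ ρ
  · exact ⟨x, h, by simp; positivity⟩
  · obtain ⟨z, h1, h2⟩ := hX.exists_dist_eq x p hρ (le_of_not_ge h) hη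
    exact ⟨z, h1.le, by linarith⟩

/-! ### Existence of families of approximate isometries -/

/-- Points of a compact set can be moved, in a measurable way with finitely many values, to points
of the set at distance at most `η`. -/
theorem IsCompact.exists_simpleFunc_dist_le {X : Type*} [MetricSpace X] [MeasurableSpace X]
    [OpensMeasurableSpace X] {K : Set X} (hK : IsCompact K) (hne : K.Nonempty) {η : ℝ}
    (hη : 0 < η) :
    ∃ g : SimpleFunc X X, ∀ x ∈ K, g x ∈ K ∧ dist (g x) x ≤ η := by
  have : TopologicalSpace.SeparableSpace K := by
    have := isCompact_iff_compactSpace.1 hK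
    infer_instance
  have := hne.to_subtype
  let e : ℕ → X := fun n => TopologicalSpace.denseSeq K n
  have he : ∀ n, e n ∈ K := fun n => (TopologicalSpace.denseSeq K n).2
  have hcov : K ⊆ ⋃ n, Metric.ball (e n) η := by
    intro x hx
    obtain ⟨n, hn⟩ := (TopologicalSpace.denseRange_denseSeq K).exists_dist_lt ⟨x, hx⟩ hη
    exact mem_iUnion.2 ⟨n, hn⟩
  obtain ⟨t, ht⟩ := hK.elim_finite_subcover _ (fun n => Metric.isOpen_ball) hcov
  obtain ⟨N, hN⟩ := t.exists_nat_subset_range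
  refine ⟨SimpleFunc.nearestPt e N, fun x hx => ⟨he _, ?_⟩⟩
  obtain ⟨n, hn, hxn⟩ := mem_iUnion₂.1 (ht hx)
  have h1 := SimpleFunc.edist_nearestPt_le e x (Finset.mem_range.1 (hN hn)).le
  rw [edist_dist, edist_dist, ENNReal.ofReal_le_ofReal_iff dist_nonneg] at h1
  rw [Metric.mem_ball, dist_comm] at hxn
  exact h1.trans hxn.le

/-- One member of a family of approximate isometries. -/
structure IsApproxIsometry {X Y : Type*} [MetricSpace X] [MetricSpace Y] [MeasurableSpace X]
    [MeasurableSpace Y] (p : X) (q : Y) (ε R : ℝ) (f : X → Y) : Prop where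
  mapsTo : MapsTo f (Metric.closedBall p R) (Metric.ball q R)
  measurable : Measurable f
  finite_image : (f '' Metric.closedBall p R).Finite
  net : ∀ y ∈ Metric.ball q R, ∃ x ∈ Metric.closedBall p R, dist y (f x) ≤ 2 * ε
  distortion : ∀ x ∈ Metric.closedBall p R, ∀ y ∈ Metric.closedBall p R,
    |dist (f x) (f y) - dist x y| ≤ ε
  basepoint : f p = q

/-- At accuracy `2 * R` every requirement is trivial on a ball of radius `R`. This serves the
finitely many indices at which no Gromov–Hausdorff approximation is available yet. -/
theorem isApproxIsometry_const {X Y : Type*} [MetricSpace X] [MetricSpace Y] [MeasurableSpace X]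
    [MeasurableSpace Y] (p : X) (q : Y) {R : ℝ} (hR : 0 < R) :
    IsApproxIsometry p q (2 * R) R (fun _ => q) where
  mapsTo := fun _ _ => Metric.mem_ball_self hR
  measurable := measurable_const
  finite_image := (finite_singleton q).subset (by rintro _ ⟨_, _, rfl⟩; rfl)
  net := fun y hy => ⟨p, Metric.mem_closedBall_self hR.le, by
    rw [Metric.mem_ball] at hy; linarith⟩
  distortion := fun x hx y hy => by
    rw [Metric.mem_closedBall] at hx hy
    have := dist_triangle_right x y p
    simp only [dist_self, zero_sub, abs_neg, abs_of_nonneg dist_nonneg]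
    linarith
  basepoint := rfl

/-- A Gromov–Hausdorff approximation of a slightly larger ball can be corrected to a measurable,
finitely valued approximate isometry of closed balls into open balls of the same radius. -/
theorem IsLengthSpace.exists_isApproxIsometry {X Y : Type*} [MetricSpace X] [ProperSpace X]
    [MetricSpace Y] [MeasurableSpace X] [BorelSpace X] [MeasurableSpace Y]
    (hX : IsLengthSpace X) {p : X} {q : Y} {η R : ℝ} (hη : 0 < η) (hη1 : η < 1) (hR : 3 * η < R)
    {f : X → Y} (hf0 : f p = q)
    (hf : ∀ x ∈ Metric.ball p (R + 1), ∀ y ∈ Metric.ball p (R + 1),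
      |dist (f x) (f y) - dist x y| < η)
    (hfn : Metric.ball q (R + 1 - η) ⊆ Metric.thickening η (f '' Metric.ball p (R + 1))) :
    ∃ f' : X → Y, IsApproxIsometry p q (12 * η) R f' := by
  obtain ⟨g, hg⟩ := (isCompact_closedBall p R).exists_simpleFunc_dist_le
    ⟨p, Metric.mem_closedBall_self (by linarith)⟩ hη
  -- The margin `3 * η` exceeds the distortion `η` of `f`, so images land in the open ball of radius
  -- `R`.
  have hret : ∀ x, ∃ z, x ∈ Metric.closedBall p R → dist z p ≤ R - 3 * η ∧ dist x z ≤ 4 * η := by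
    intro x
    by_cases hx : x ∈ Metric.closedBall p R
    · obtain ⟨z, h1, h2⟩ := hX.exists_retract x p (ρ := R - 3 * η) (s := 3 * η) (η := η)
        (by linarith) (by rw [Metric.mem_closedBall] at hx; linarith) (by linarith) hη
      exact ⟨z, fun _ => ⟨h1, by linarith⟩⟩
    · exact ⟨x, fun h => absurd h hx⟩
  choose c hc using hret
  -- The base point is treated separately because it has to be mapped exactly to `q`.
  let G : SimpleFunc X X :=
    SimpleFunc.piecewise {p} (measurableSet_singleton p) (SimpleFunc.const X p) (g.map c)
  have hGp : G p = p := by simp [G]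
  have hG : ∀ x ∈ Metric.closedBall p R, dist (G x) p ≤ R - 3 * η ∧ dist (G x) x ≤ 5 * η := by
    intro x hx
    by_cases h : x = p
    · subst h
      simp only [hGp, dist_self]
      exact ⟨by linarith, by linarith⟩
    · have h1 : G x = c (g x) := by simp [G, h]
      obtain ⟨h2, h3⟩ := hg x hx
      obtain ⟨h4, h5⟩ := hc _ h2
      rw [h1]
      refine ⟨h4, ?_⟩
      have := dist_triangle (c (g x)) (g x) x
      rw [dist_comm] at h5
      linarith
  have hGb : ∀ x ∈ Metric.closedBall p R, G x ∈ Metric.ball p (R + 1) := fun x hx => by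
    rw [Metric.mem_ball]; linarith [(hG x hx).1]
  have hp : p ∈ Metric.ball p (R + 1) := Metric.mem_ball_self (by linarith)
  refine ⟨G.map f, ⟨?_, (G.map f).measurable, ?_, ?_, ?_, ?_⟩⟩
  · intro x hx
    have h1 := (abs_lt.1 (hf _ (hGb x hx) p hp)).2
    rw [hf0] at h1
    rw [SimpleFunc.map_apply, Metric.mem_ball]
    linarith [(hG x hx).1]
  · exact ((G.map f).finite_range).subset (image_subset_range _ _)
  · intro y hy
    rw [Metric.mem_ball] at hy
    have hy' : y ∈ Metric.ball q (R + 1 - η) := by rw [Metric.mem_ball]; linarith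
    obtain ⟨_, ⟨x, hx, rfl⟩, hyx⟩ := Metric.mem_thickening_iff.1 (hfn hy')
    have h1 := (abs_lt.1 (hf x hx p hp)).1
    have h2 := dist_triangle_left (f x) q y
    rw [hf0] at h1
    obtain ⟨w, hw, hxw⟩ := hX.exists_retract x p (ρ := R) (s := 2 * η) (η := η) (by linarith)
      (by linarith) (by linarith) hη
    refine ⟨w, hw, ?_⟩
    have h3 := (abs_lt.1 (hf x hx _ (hGb w hw))).2
    have h4 := dist_triangle_right x (G w) w
    have h5 := dist_triangle y (f x) (f (G w))
    have h6 := (hG w hw).2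
    rw [SimpleFunc.map_apply]
    linarith
  -- `G` moves each of the two points by at most `5 * η` and `f` adds `η`, in total `11 * η`.
  · intro x hx y hy
    rw [SimpleFunc.map_apply, SimpleFunc.map_apply]
    have h1 := abs_lt.1 (hf _ (hGb x hx) _ (hGb y hy))
    have h2 := (hG x hx).2
    have h3 := (hG y hy).2
    have h4 := dist_triangle4 (G x) x y (G y)
    have h5 := dist_triangle4 x (G x) (G y) y
    rw [dist_comm y] at h4
    rw [dist_comm x (G x)] at h5
    rw [abs_le]
    constructor <;> linarith [h1.1, h1.2]
  · rw [SimpleFunc.map_apply, hGp, hf0]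

/-- If each property `P k` holds eventually, and `P 0` always, then one can let `k` grow slowly
with `n`. -/
theorem exists_monotone_tendsto_of_eventually {P : ℕ → ℕ → Prop} (h0 : ∀ n, P 0 n)
    (h : ∀ k, ∀ᶠ n in atTop, P k n) :
    ∃ κ : ℕ → ℕ, Monotone κ ∧ Tendsto κ atTop atTop ∧ ∀ n, P (κ n) n := by
  classical
  -- Quantifying over all later indices makes `Q n k` persist as `n` grows, which gives monotonicity
  -- of `κ`.
  let Q : ℕ → ℕ → Prop := fun n k => ∀ n' ≥ n, P k n'
  let κ : ℕ → ℕ := fun n => Nat.findGreatest (Q n) n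
  have hQ : ∀ n, Q n (κ n) := fun n =>
    Nat.findGreatest_spec (P := Q n) (Nat.zero_le n) (fun n' _ => h0 n')
  have hm : Monotone κ := fun a b hab =>
    Nat.le_findGreatest ((Nat.findGreatest_le a).trans hab) fun n' hn' => hQ a n' (hab.trans hn')
  refine ⟨κ, hm, ?_, fun n => hQ n n le_rfl⟩
  refine tendsto_atTop_atTop_of_monotone hm fun k => ?_
  obtain ⟨N, hN⟩ := eventually_atTop.1 (h k)
  exact ⟨max N k, Nat.le_findGreatest (le_max_right _ _)
    fun n' hn' => hN n' ((le_max_left _ _).trans hn')⟩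

/-- For each `k` the accuracy `e k` on radius `ρ k` is reached for all large `n`, and `k = 0` is
covered by the constant map because `e 0 = 2 * ρ 0`. The division of `e k` by `12` compensates the
loss in the correction step. -/
theorem PointedGHTendsto.exists_isApproxIsometryFamily
    {X : ℕ → Type*} [∀ n, MetricSpace (X n)] [∀ n, ProperSpace (X n)]
    [∀ n, MeasurableSpace (X n)] [∀ n, BorelSpace (X n)]
    (hlen : ∀ n, IsLengthSpace (X n)) (m : ∀ n, Measure (X n))
    {Y : Type*} [MetricSpace Y] [MeasurableSpace Y]
    {p : ∀ n, X n} {q : Y} (hGH : PointedGHTendsto X p Y q) :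
    ∃ (ε R : ℕ → ℝ) (f : ∀ n, X n → Y), IsApproxIsometryFamily X m p Y q ε R f := by
  let e : ℕ → ℝ := fun k => 2 / ((k : ℝ) + 1)
  let ρ : ℕ → ℝ := fun k => (k : ℝ) + 1
  have he : ∀ k, 0 < e k := fun k => by positivity
  have he2 : ∀ k, e k ≤ 2 := fun k => by
    rw [div_le_iff₀ (by positivity)]
    have : (0 : ℝ) ≤ k := by positivity
    linarith
  obtain ⟨κ, hκm, hκt, hκ⟩ := exists_monotone_tendsto_of_eventually
    (P := fun k n => ∃ f : X n → Y, IsApproxIsometry (p n) q (e k) (ρ k) f)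
    (fun n => ⟨fun _ => q, by simpa [e, ρ] using isApproxIsometry_const (p n) q one_pos⟩)
    (fun k => by
      have hk : (1 : ℝ) ≤ ρ k := by simp [ρ]
      obtain ⟨i₀, hi₀⟩ := hGH (ρ k + 1) (e k / 12) (by linarith [he k]) (by linarith [he2 k])
      filter_upwards [eventually_ge_atTop i₀] with n hn
      obtain ⟨f, hf0, hf, hfn⟩ := hi₀ n hn
      obtain ⟨f', hf'⟩ := (hlen n).exists_isApproxIsometry (by linarith [he k])
        (by linarith [he2 k]) (by linarith [he2 k]) hf0 hf hfn
      exact ⟨f', by convert hf' using 1; ring⟩)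
  choose f hf using hκ
  refine ⟨fun n => e (κ n), fun n => ρ (κ n), f, ?_⟩
  exact
    { eps_pos := fun n => he _
      eps_antitone := fun a b hab => by
        have := hκm hab
        simp only [e]
        gcongr
      eps_tendsto := by
        refine Tendsto.comp (g := e) ?_ hκt
        have := tendsto_one_div_add_atTop_nhds_zero_nat (𝕜 := ℝ)
        simpa [e, div_eq_mul_inv] using this.const_mul 2
      R_pos := fun n => by positivity
      R_monotone := fun a b hab => by
        have := hκm hab
        simp only [ρ]
        gcongr
      R_tendsto := by
        refine Tendsto.comp (g := ρ) ?_ hκt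
        exact tendsto_atTop_add_const_right _ _ tendsto_natCast_atTop_atTop
      mapsTo := fun n => (hf n).mapsTo
      aemeasurable := fun n => (hf n).measurable.aemeasurable
      finite_image := fun n => (hf n).finite_image
      net := fun n => (hf n).net
      distortion := fun n => (hf n).distortion
      basepoint := fun n => (hf n).basepoint }

/-! ### Decay of the volume of annuli -/

/-- The constant in the comparison of a set with the balls it contains. -/
noncomputable def coveringConstant (C α' : ℝ) : ℝ≥0∞ :=
  -- `40` is the ratio of the radii `5 * s` and `s / 8`; the three factors `C` come from the upper
  -- volume bound, the growth of `V` and the lower volume bound.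
  ENNReal.ofReal (C ^ 3 * 40 ^ α')

theorem coveringConstant_ne_top (C α' : ℝ) : coveringConstant C α' ≠ ⊤ := ENNReal.ofReal_ne_top

theorem HasPowerGrowth.mul_le {V : ℝ → ℝ} {C α α' : ℝ} (hg : HasPowerGrowth V C α α')
    (hV : IsVolumeGauge V) {r t : ℝ} (hr : 0 < r) (ht : 1 ≤ t) : V (t * r) ≤ C * t ^ α' * V r := by
  have h := (hg r (t * r) hr (by nlinarith)).2
  rwa [mul_div_cancel_right₀ _ hr.ne', div_le_iff₀ (hV.pos r hr)] at h

section

variable {X : Type*} [MetricSpace X] [MeasurableSpace X] {μ : Measure X} {V : ℝ → ℝ} {C α α' : ℝ}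

theorem HasVolumeGrowth.ball_le_ball (hμ : HasVolumeGrowth μ V C) (hC : 1 ≤ C)
    (hV : IsVolumeGauge V) (hg : HasPowerGrowth V C α α') {s : ℝ} (hs : 0 < s)
    (hsd : ENNReal.ofReal (5 * s) < Metric.ediam (univ : Set X)) (x y : X) :
    μ (Metric.ball x (5 * s)) ≤ coveringConstant C α' * μ (Metric.ball y (s / 8)) := by
  have h1 := (hμ x (5 * s) (by linarith) hsd).2
  have h2 := (hμ y (s / 8) (by linarith)
    ((ENNReal.ofReal_le_ofReal (by linarith)).trans_lt hsd)).1
  have h3 := hg.mul_le hV (r := s / 8) (t := 40) (by linarith) (by norm_num)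
  rw [show 40 * (s / 8) = 5 * s by ring] at h3
  refine h1.trans (le_trans ?_ (mul_le_mul_right h2 _))
  rw [coveringConstant, ← ENNReal.ofReal_mul (by positivity)]
  apply ENNReal.ofReal_le_ofReal
  have : C ^ 3 * 40 ^ α' * (C⁻¹ * V (s / 8)) = C * (C * 40 ^ α' * V (s / 8)) := by
    field_simp
  rw [this]
  gcongr

variable [ProperSpace X] [BorelSpace X]

/-- A set is controlled by another set if close to each of its points, the other one contains
balls of a comparable radius. -/
theorem HasVolumeGrowth.measure_le_of_forall_exists_ball (hμ : HasVolumeGrowth μ V C) (hC : 1 ≤ C)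
    (hV : IsVolumeGauge V) (hg : HasPowerGrowth V C α α') {s : ℝ} (hs : 0 < s)
    (hsd : ENNReal.ofReal (5 * s) < Metric.ediam (univ : Set X)) {S T : Set X}
    (hST : ∀ x ∈ S, ∃ y, Metric.ball y (s / 8) ⊆ Metric.closedBall x s ∩ T) :
    μ S ≤ coveringConstant C α' * μ T := by
  -- Disjoint balls of radius `s` are chosen whose fourfold enlargements cover `S`; each contains
  -- its own small ball inside `T`, so these small balls are disjoint as well.
  obtain ⟨u, huS, hud, huc⟩ := Vitali.exists_disjoint_subfamily_covering_enlargement_closedBall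
    S (fun x : X => x) (fun _ => s) s (fun _ _ => le_rfl) 4 (by norm_num)
  have hun : u.Countable := hud.countable_of_nonempty_interior fun x _ =>
    ⟨x, mem_interior_iff_mem_nhds.2 (Metric.closedBall_mem_nhds x hs)⟩
  have hST' : ∀ x, ∃ y, x ∈ S → Metric.ball y (s / 8) ⊆ Metric.closedBall x s ∩ T := fun x => by
    by_cases hx : x ∈ S
    · obtain ⟨y, hy⟩ := hST x hx
      exact ⟨y, fun _ => hy⟩
    · exact ⟨x, fun h => absurd h hx⟩
  choose c hc using hST'
  have hcov : S ⊆ ⋃ x ∈ u, Metric.ball x (5 * s) := by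
    intro a ha
    obtain ⟨b, hb, hab⟩ := huc a ha
    refine mem_iUnion₂.2 ⟨b, hb, ?_⟩
    exact Metric.closedBall_subset_ball (by linarith) (hab (Metric.mem_closedBall_self hs.le))
  have hdisj : u.PairwiseDisjoint fun x => Metric.ball (c x) (s / 8) := fun a ha b hb hab =>
    (hud ha hb hab).mono (fun z hz => (hc a (huS ha) hz).1) (fun z hz => (hc b (huS hb) hz).1)
  calc μ S ≤ μ (⋃ x ∈ u, Metric.ball x (5 * s)) := measure_mono hcov
    _ ≤ ∑' x : u, μ (Metric.ball (x : X) (5 * s)) := measure_biUnion_le μ hun _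
    _ ≤ ∑' x : u, coveringConstant C α' * μ (Metric.ball (c x) (s / 8)) :=
        ENNReal.tsum_le_tsum fun x => hμ.ball_le_ball hC hV hg hs hsd _ _
    _ = coveringConstant C α' * μ (⋃ x ∈ u, Metric.ball (c x) (s / 8)) := by
        rw [ENNReal.tsum_mul_left, measure_biUnion hun hdisj fun _ _ => measurableSet_ball]
    _ ≤ coveringConstant C α' * μ T := by
        gcongr
        exact iUnion₂_subset fun x hx z hz => (hc x (huS hx) hz).2

/-- An almost shortest curve from a point of the outer shell to `p` crosses the sphere of radius `ρ
- δ` at distance at most `5 * δ / 2`; the ball of radius `δ / 2` around the crossing point lies in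
the inner shell. -/
theorem HasVolumeGrowth.shell_le_shell (hμ : HasVolumeGrowth μ V C) (hC : 1 ≤ C)
    (hV : IsVolumeGauge V) (hg : HasPowerGrowth V C α α') (hX : IsLengthSpace X) (p : X)
    {ρ δ : ℝ} (hδ : 0 < δ) (hρ : 4 * δ ≤ ρ)
    (hd : ENNReal.ofReal (20 * δ) < Metric.ediam (univ : Set X)) :
    μ {x | ρ ≤ dist x p ∧ dist x p ≤ ρ + δ} ≤
      coveringConstant C α' * μ {x | ρ - 4 * δ ≤ dist x p ∧ dist x p < ρ} := by
  refine hμ.measure_le_of_forall_exists_ball hC hV hg (s := 4 * δ) (by linarith)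
    (by rwa [show 5 * (4 * δ) = 20 * δ by ring]) ?_
  rintro x ⟨hx1, hx2⟩
  obtain ⟨z, hz1, hz2⟩ := hX.exists_dist_eq x p (t := ρ - δ) (η := δ / 2) (by linarith)
    (by linarith) (by linarith)
  refine ⟨z, fun y hy => ?_⟩
  rw [Metric.mem_ball] at hy
  have h1 := dist_triangle y z p
  have h2 := dist_triangle_left z p y
  have h3 := dist_triangle_right y x z
  refine ⟨?_, ?_, ?_⟩
  · rw [Metric.mem_closedBall]; linarith
  · linarith
  · linarith

/-- The upper volume bound extends to balls of all radii. -/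
theorem HasVolumeGrowth.ball_le [Nontrivial X] (hμ : HasVolumeGrowth μ V C) (hC : 1 ≤ C)
    (hV : IsVolumeGauge V) (hg : HasPowerGrowth V C α α') (hX : IsLengthSpace X) (x : X)
    {r : ℝ} (hr : 0 < r) :
    μ (Metric.ball x r) ≤ (1 + coveringConstant C α') * ENNReal.ofReal (C * V r) := by
  rcases lt_or_ge (ENNReal.ofReal r) (Metric.ediam (univ : Set X)) with h | h
  · refine (hμ x r hr h).2.trans ?_
    exact le_mul_of_one_le_left' le_self_add
  have hfin : Metric.ediam (univ : Set X) ≠ ⊤ := ne_top_of_le_ne_top ENNReal.ofReal_ne_top h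
  set d := (Metric.ediam (univ : Set X)).toReal with hd
  have hdd : ENNReal.ofReal d = Metric.ediam (univ : Set X) := ENNReal.ofReal_toReal hfin
  have hd0 : 0 < d := ENNReal.toReal_pos
    (Metric.ediam_pos_iff.2 nontrivial_univ).ne' hfin
  have hdr : d ≤ r := by
    rw [← hdd] at h
    exact (ENNReal.ofReal_le_ofReal_iff hr.le).1 h
  have hdist : ∀ y : X, dist y x ≤ d := fun y => by
    have := Metric.edist_le_ediam_of_mem (mem_univ y) (mem_univ x)
    rwa [← hdd, edist_dist, ENNReal.ofReal_le_ofReal_iff hd0.le] at this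
  have hlt : ∀ t : ℝ, t < d → ENNReal.ofReal t < Metric.ediam (univ : Set X) := fun t ht => by
    rw [← hdd]
    exact (ENNReal.ofReal_lt_ofReal_iff hd0).2 ht
  -- With `ρ + δ = d`, a ball of radius below the diameter and one thin shell fill the space, while
  -- `20 * δ < d` permits the shell estimate.
  set ρ := 24 / 25 * d with hρ
  set δ := d / 25 with hδ
  have h1 := hμ.shell_le_shell hC hV hg hX x (ρ := ρ) (δ := δ) (by positivity)
    (by rw [hρ, hδ]; linarith) (hlt _ (by rw [hδ]; linarith))
  have h2 : μ (Metric.ball x ρ) ≤ ENNReal.ofReal (C * V r) := by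
    refine (hμ x ρ (by positivity) (hlt _ (by rw [hρ]; linarith))).2.trans ?_
    apply ENNReal.ofReal_le_ofReal
    have := hV.mono ρ r (by positivity) (by rw [hρ]; linarith)
    gcongr
  have hsub : Metric.ball x r ⊆ Metric.ball x ρ ∪ {y | ρ ≤ dist y x ∧ dist y x ≤ ρ + δ} := by
    intro y _
    rcases lt_or_ge (dist y x) ρ with hy | hy
    · exact Or.inl hy
    · refine Or.inr ⟨hy, ?_⟩
      have := hdist y
      rw [hρ, hδ]
      linarith
  calc μ (Metric.ball x r) ≤ μ (Metric.ball x ρ) + μ {y | ρ ≤ dist y x ∧ dist y x ≤ ρ + δ} :=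
        (measure_mono hsub).trans (measure_union_le _ _)
    _ ≤ μ (Metric.ball x ρ) + coveringConstant C α' * μ (Metric.ball x ρ) := by
        gcongr
        refine h1.trans ?_
        gcongr
        exact fun y hy => hy.2
    _ = (1 + coveringConstant C α') * μ (Metric.ball x ρ) := by ring
    _ ≤ _ := by gcongr

/-- One step of the annular decay. -/
theorem HasVolumeGrowth.annulus_le (hμ : HasVolumeGrowth μ V C) (hC : 1 ≤ C)
    (hV : IsVolumeGauge V) (hg : HasPowerGrowth V C α α') (hX : IsLengthSpace X) (p : X)
    {R δ : ℝ} (hδ : 0 < δ) (hR : 41 * δ < R) :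
    μ {x | |dist x p - R| ≤ δ} ≤
      coveringConstant C α' / (1 + coveringConstant C α') * μ {x | |dist x p - R| ≤ 9 * δ} := by
  set k := coveringConstant C α' with hk
  have hk1 : k ≠ ⊤ := coveringConstant_ne_top C α'
  have hset : ∀ t : ℝ, {x | |dist x p - R| ≤ t} = {x | R - t ≤ dist x p ∧ dist x p ≤ R + t} := by
    intro t
    ext x
    simp only [mem_ofPred_eq, abs_le]
    constructor <;> rintro ⟨h1, h2⟩ <;> constructor <;> linarith
  rcases eq_empty_or_nonempty {x | |dist x p - R| ≤ δ} with he | ⟨x₀, hx₀⟩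
  · rw [he]; simp
  -- A point of the annulus is at distance at least `R - δ > 40 * δ` from `p`.
  have hd : ENNReal.ofReal (20 * (2 * δ)) < Metric.ediam (univ : Set X) := by
    refine lt_of_lt_of_le ?_ (Metric.edist_le_ediam_of_mem (mem_univ x₀) (mem_univ p))
    rw [mem_ofPred_eq] at hx₀
    have := (abs_le.1 hx₀).1
    rw [edist_dist, ENNReal.ofReal_lt_ofReal_iff (by linarith)]
    linarith
  have h1 := hμ.shell_le_shell hC hV hg hX p (ρ := R - δ) (δ := 2 * δ) (by linarith)
    (by linarith) hd
  rw [show R - δ + 2 * δ = R + δ by ring, ← hset, show R - δ - 4 * (2 * δ) = R - 9 * δ by ring,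
    ← hk] at h1
  set a := μ {x | |dist x p - R| ≤ δ}
  set T := {x | R - 9 * δ ≤ dist x p ∧ dist x p < R - δ}
  have hmeas : MeasurableSet {x | |dist x p - R| ≤ δ} :=
    (isClosed_le (by fun_prop) (by fun_prop)).measurableSet
  have hdisj : Disjoint T {x | |dist x p - R| ≤ δ} := by
    rw [hset, Set.disjoint_left]
    rintro x hx1 hx2
    exact absurd hx1.2 (not_lt.2 hx2.1)
  have h2 : μ T + a ≤ μ {x | |dist x p - R| ≤ 9 * δ} := by
    rw [← measure_union hdisj hmeas]
    refine measure_mono (union_subset ?_ ?_)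
    · rw [hset]
      rintro x ⟨hx1, hx2⟩
      exact ⟨hx1, by linarith⟩
    · intro x hx
      rw [mem_ofPred_eq] at hx ⊢
      linarith
  -- From `a ≤ k * μ T` and `μ T + a ≤ b` follows `(1 + k) * a ≤ k * b`, without subtracting
  -- possibly infinite measures.
  rw [div_eq_mul_inv, mul_right_comm, ← div_eq_mul_inv,
    ENNReal.le_div_iff_mul_le (Or.inl (by simp)) (Or.inl (by finiteness))]
  calc a * (1 + k) = a + k * a := by ring
    _ ≤ k * μ T + k * a := by gcongr
    _ = k * (μ T + a) := by ring
    _ ≤ _ := by gcongr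

/-- Annuli around metric spheres have small measure, at a rate that only depends on the growth
constants. -/
theorem HasVolumeGrowth.annulus_le_pow (hμ : HasVolumeGrowth μ V C) (hC : 1 ≤ C)
    (hV : IsVolumeGauge V) (hg : HasPowerGrowth V C α α') (hX : IsLengthSpace X) (p : X)
    {R : ℝ} (hR : 0 < R) (j : ℕ) :
    μ {x | |dist x p - R| ≤ R / 50 / 9 ^ j} ≤
      (coveringConstant C α' / (1 + coveringConstant C α')) ^ j * μ (Metric.ball p (2 * R)) := by
  induction j with
  | zero =>
    simp only [pow_zero, div_one, one_mul]
    refine measure_mono fun x hx => ?_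
    rw [mem_ofPred_eq] at hx
    rw [Metric.mem_ball]
    linarith [(abs_le.1 hx).2]
  | succ j ih =>
    have h9 : (1 : ℝ) ≤ 9 ^ (j + 1) := one_le_pow₀ (by norm_num)
    -- Starting at thickness `R / 50` keeps `41 * δ < R` at every scale.
    have h := hμ.annulus_le hC hV hg hX p (R := R) (δ := R / 50 / 9 ^ (j + 1)) (by positivity) (by
      rw [← lt_div_iff₀' (by norm_num)]
      exact (div_le_self (by positivity) h9).trans_lt (by linarith))
    rw [show 9 * (R / 50 / 9 ^ (j + 1)) = R / 50 / 9 ^ j by rw [pow_succ]; field_simp] at h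
    refine h.trans ?_
    rw [pow_succ', mul_assoc]
    gcongr

end

theorem coveringConstant_div_lt_one (C α' : ℝ) :
    coveringConstant C α' / (1 + coveringConstant C α') < 1 := by
  have h := coveringConstant_ne_top C α'
  rw [ENNReal.div_lt_iff (Or.inl (by simp)) (Or.inl (by finiteness)), one_mul, add_comm]
  exact ENNReal.lt_add_right h one_ne_zero

/-! ### Tent functions and vague compactness -/

open scoped CompactlySupported


/-- The continuous function that is `1` on `closedBall x r`, `0` outside `ball x (r + δ)`, and
affine in the distance to `x` in between. -/
noncomputable def tent {Y : Type*} [MetricSpace Y] (x : Y) (r δ : ℝ) (y : Y) : ℝ :=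
  max 0 (min 1 (1 + (r - dist y x) / δ))

section

variable {Y : Type*} [MetricSpace Y]

theorem continuous_tent (x : Y) (r δ : ℝ) : Continuous (tent x r δ) := by
  unfold tent
  fun_prop

theorem tent_nonneg (x : Y) (r δ : ℝ) (y : Y) : 0 ≤ tent x r δ y := le_max_left _ _

theorem tent_le_one (x : Y) (r δ : ℝ) (y : Y) : tent x r δ y ≤ 1 :=
  max_le zero_le_one (min_le_left _ _)

theorem tent_eq_one {x : Y} {r δ : ℝ} (hδ : 0 < δ) {y : Y} (h : dist y x ≤ r) :
    tent x r δ y = 1 := by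
  have : 0 ≤ (r - dist y x) / δ := div_nonneg (by linarith) hδ.le
  rw [tent, min_eq_left (by linarith), max_eq_right zero_le_one]

theorem tent_eq_zero {x : Y} {r δ : ℝ} (hδ : 0 < δ) {y : Y} (h : r + δ ≤ dist y x) :
    tent x r δ y = 0 := by
  have : (r - dist y x) / δ ≤ -1 := by
    rw [div_le_iff₀ hδ]
    linarith
  rw [tent, min_eq_right (by linarith), max_eq_left (by linarith)]

theorem hasCompactSupport_of_eq_zero [ProperSpace Y] {φ : Y → ℝ} {x : Y} {r : ℝ}
    (h : ∀ y, r < dist y x → φ y = 0) : HasCompactSupport φ :=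
  HasCompactSupport.intro (isCompact_closedBall x r) fun y hy =>
    h y (by simpa [Metric.mem_closedBall] using hy)

theorem hasCompactSupport_tent [ProperSpace Y] {x : Y} {r δ : ℝ} (hδ : 0 < δ) :
    HasCompactSupport (tent x r δ) :=
  hasCompactSupport_of_eq_zero (x := x) (r := r + δ) fun _ hy => tent_eq_zero hδ hy.le

variable [MeasurableSpace Y]

theorem isFiniteMeasureOnCompacts_of_closedBall {μ : Measure Y} (q : Y)
    (h : ∀ r, μ (Metric.closedBall q r) < ⊤) : IsFiniteMeasureOnCompacts μ where
  lt_top_of_isCompact K hK := by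
    obtain ⟨r, hr⟩ := hK.isBounded.subset_closedBall q
    exact (measure_mono hr).trans_lt (h r)

theorem abs_integral_le_of_eq_zero [OpensMeasurableSpace Y] {μ : Measure Y} {q : Y} {r c K : ℝ}
    {f : Y → ℝ} (hμ : μ (Metric.closedBall q r) ≤ ENNReal.ofReal K) (hK : 0 ≤ K)
    (h0 : ∀ y, r < dist y q → f y = 0) (hc : ∀ y, dist y q ≤ r → |f y| ≤ c) (hc0 : 0 ≤ c) :
    |∫ y, f y ∂μ| ≤ c * K := by
  rw [← setIntegral_eq_integral_of_forall_compl_eq_zero (s := Metric.closedBall q r)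
    (fun y hy => h0 y (by simpa [Metric.mem_closedBall] using hy)), ← Real.norm_eq_abs]
  refine (norm_setIntegral_le_of_norm_le_const (C := c) (hμ.trans_lt ENNReal.ofReal_lt_top)
    (fun y hy => hc y hy)).trans ?_
  exact mul_le_mul_of_nonneg_left (ENNReal.toReal_le_of_le_ofReal hK hμ) hc0

end

/-- Diagonal sequences: pointwise bounded sequences of functions on a countable set have pointwise
convergent subsequences. -/
theorem exists_subseq_tendsto_of_countable {ι : Type*} [Countable ι] {a : ℕ → ι → ℝ} {B : ι → ℝ}
    (hB : ∀ n i, |a n i| ≤ B i) :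
    ∃ k : ℕ → ℕ, StrictMono k ∧ ∀ i, ∃ l, Tendsto (fun n => a (k n) i) atTop (𝓝 l) := by
  obtain ⟨l, -, k, hk, hl⟩ :=
    (isCompact_univ_pi fun i => isCompact_Icc (a := -B i) (b := B i)).tendsto_subseq
      (x := a) (fun n i _ => abs_le.1 (hB n i))
  exact ⟨k, hk, fun i => ⟨l i, (tendsto_pi_nhds.1 hl) i⟩⟩

/-- A sequence of reals that is uniformly approximated by convergent ones converges. -/
theorem exists_tendsto_of_forall_approx {s : ℕ → ℝ}
    (h : ∀ ε > 0, ∃ t : ℕ → ℝ, (∃ l, Tendsto t atTop (𝓝 l)) ∧ ∀ n, |s n - t n| ≤ ε) :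
    ∃ l, Tendsto s atTop (𝓝 l) := by
  refine cauchySeq_tendsto_of_complete (Metric.cauchySeq_iff.2 fun ε hε => ?_)
  obtain ⟨t, ⟨l, hl⟩, ht⟩ := h (ε / 4) (by positivity)
  obtain ⟨N, hN⟩ := Metric.cauchySeq_iff.1 hl.cauchySeq (ε / 4) (by positivity)
  refine ⟨N, fun m hm n hn => ?_⟩
  have h1 := hN m hm n hn
  rw [Real.dist_eq] at h1 ⊢
  have h2 := abs_le.1 (ht m)
  have h3 := abs_le.1 (ht n)
  have h4 := abs_lt.1 h1
  rw [abs_lt]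
  constructor <;> linarith [h2.1, h2.2, h3.1, h3.2, h4.1, h4.2]

/-- Vague sequential compactness of locally uniformly bounded measures on a proper metric space. -/
theorem exists_subseq_tendsto_integral {Y : Type*} [MetricSpace Y] [ProperSpace Y]
    [MeasurableSpace Y] [BorelSpace Y] (q : Y) (μ : ℕ → Measure Y) {K : ℝ → ℝ}
    (hK : ∀ r, 0 ≤ K r) (hμ : ∀ r n, μ n (Metric.closedBall q r) ≤ ENNReal.ofReal (K r)) :
    ∃ k : ℕ → ℕ, StrictMono k ∧ ∃ ν : Measure Y, ν.Regular ∧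
      ∀ φ : Y → ℝ, Continuous φ → HasCompactSupport φ →
        Tendsto (fun i => ∫ y, φ y ∂(μ (k i))) atTop (𝓝 (∫ y, φ y ∂ν)) := by
  have hfin : ∀ n, IsFiniteMeasureOnCompacts (μ n) := fun n =>
    isFiniteMeasureOnCompacts_of_closedBall q fun r => (hμ r n).trans_lt ENNReal.ofReal_lt_top
  -- `C(Y, ℝ)` is separable for the compact-open topology, so the countably many products `tent q N
  -- 1 * g j` suffice as test functions.
  let g : ℕ → C(Y, ℝ) := TopologicalSpace.denseSeq C(Y, ℝ)
  have hgb : ∀ i : ℕ × ℕ, ∃ B, 0 ≤ B ∧ ∀ y, dist y q ≤ i.1 + 1 → |g i.2 y| ≤ B := by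
    rintro ⟨N, j⟩
    obtain ⟨B, hB⟩ := (isCompact_closedBall q ((N : ℝ) + 1)).exists_bound_of_continuousOn
      (g j).continuous.continuousOn
    exact ⟨max B 0, le_max_right _ _, fun y hy => (hB y hy).trans (le_max_left _ _)⟩
  choose B hB0 hB using hgb
  obtain ⟨k, hk, hconv⟩ := exists_subseq_tendsto_of_countable
    (a := fun n (i : ℕ × ℕ) => ∫ y, tent q i.1 1 y * g i.2 y ∂(μ n))
    (B := fun i => B i * K (i.1 + 1)) (by
      intro n i
      refine abs_integral_le_of_eq_zero (hμ _ n) (hK _) ?_ ?_ (hB0 i)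
      · intro y hy
        rw [tent_eq_zero one_pos hy.le, zero_mul]
      · intro y hy
        rw [abs_mul, abs_of_nonneg (tent_nonneg _ _ _ _)]
        exact (mul_le_of_le_one_left (abs_nonneg _) (tent_le_one _ _ _ _)).trans (hB i y hy))
  have hlim : ∀ φ : C_c(Y, ℝ), ∃ l, Tendsto (fun i => ∫ y, φ y ∂(μ (k i))) atTop (𝓝 l) := by
    intro φ
    obtain ⟨r, hr⟩ := φ.hasCompactSupport.isBounded.subset_closedBall q
    obtain ⟨N, hN⟩ := exists_nat_ge r
    have hφ0 : ∀ y, (N : ℝ) < dist y q → φ y = 0 := fun y hy =>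
      image_eq_zero_of_notMem_tsupport fun h => by
        have := hr h
        rw [Metric.mem_closedBall] at this
        linarith
    refine exists_tendsto_of_forall_approx fun ε hε => ?_
    set η := ε / (K (N + 1) + 1) with hη
    have hK' : 0 < K (N + 1) + 1 := by linarith [hK (N + 1)]
    have hη0 : 0 < η := by positivity
    have hnhds : {h : C(Y, ℝ) | ∀ y ∈ Metric.closedBall q ((N : ℝ) + 1), dist (φ y) (h y) < η}
        ∈ 𝓝 φ.toContinuousMap :=
      Metric.tendstoUniformlyOn_iff.1
        (ContinuousMap.tendsto_iff_forall_isCompact_tendstoUniformlyOn.1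
          (tendsto_id (x := 𝓝 φ.toContinuousMap)) _ (isCompact_closedBall q ((N : ℝ) + 1))) η hη0
    obtain ⟨_, hj, j, rfl⟩ := mem_closure_iff_nhds.1
      ((TopologicalSpace.denseRange_denseSeq C(Y, ℝ)) φ.toContinuousMap) _ hnhds
    refine ⟨_, hconv (N, j), fun n => ?_⟩
    have hint : Integrable (fun y => tent q N 1 y * g j y) (μ (k n)) :=
      ((continuous_tent q N 1).mul (g j).continuous).integrable_of_hasCompactSupport
        (hasCompactSupport_tent one_pos).mul_right
    rw [← integral_sub φ.integrable hint]
    refine (abs_integral_le_of_eq_zero (c := η) (hμ (N + 1) _) (hK _) ?_ ?_ hη0.le).trans ?_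
    · intro y hy
      rw [hφ0 y (by linarith), tent_eq_zero one_pos hy.le, zero_mul, sub_zero]
    · intro y hy
      have h1 : φ y = tent q N 1 y * φ y := by
        rcases le_or_gt (dist y q) N with h | h
        · rw [tent_eq_one one_pos h, one_mul]
        · rw [hφ0 y h, mul_zero]
      rw [h1, ← mul_sub, abs_mul, abs_of_nonneg (tent_nonneg _ _ _ _)]
      exact (mul_le_of_le_one_left (abs_nonneg _) (tent_le_one _ _ _ _)).trans (hj y hy).le
    · rw [hη, div_mul_eq_mul_div, div_le_iff₀ hK']
      nlinarith [hK (N + 1)]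
  choose L hL using hlim
  -- The limits of the integrals form a positive linear functional, represented by a regular
  -- measure.
  let Λ : C_c(Y, ℝ) →ₚ[ℝ] ℝ :=
    { toFun := L
      map_add' := fun φ ψ => tendsto_nhds_unique (hL (φ + ψ)) <| by
        refine ((hL φ).add (hL ψ)).congr fun i => ?_
        exact (integral_add φ.integrable ψ.integrable).symm
      map_smul' := fun c φ => tendsto_nhds_unique (hL (c • φ)) <| by
        refine ((hL φ).const_mul c).congr fun i => ?_
        exact (integral_const_mul c _).symm
      monotone' := fun φ ψ h => le_of_tendsto_of_tendsto' (hL φ) (hL ψ) fun i =>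
        integral_mono φ.integrable ψ.integrable h }
  refine ⟨k, hk, RealRMK.rieszMeasure Λ, inferInstance, fun φ hφ hφc => ?_⟩
  have h := RealRMK.integral_rieszMeasure Λ ⟨⟨φ, hφ⟩, hφc⟩
  have h' := hL ⟨⟨φ, hφ⟩, hφc⟩
  exact (congrArg 𝓝 h) ▸ h'

/-! ### From vague convergence to weak convergence on balls -/

/-- The tent vanishes from radius `r - δ` on, before the values of `φ` outside the ball can matter.
-/
theorem continuous_mul_tent {Y : Type*} [MetricSpace Y] {φ : Y → ℝ} {q : Y} {r δ : ℝ}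
    (hφ : ContinuousOn φ (Metric.ball q r)) (hδ : 0 < δ) :
    Continuous fun y => φ y * tent q (r - 2 * δ) δ y := by
  refine continuous_iff_continuousAt.2 fun y => ?_
  rcases lt_or_ge (dist y q) r with hy | hy
  · exact (hφ.continuousAt (Metric.isOpen_ball.mem_nhds hy)).mul
      (continuous_tent q (r - 2 * δ) δ).continuousAt
  · have h : ∀ᶠ z in 𝓝 y, r - δ < dist z q :=
      (continuous_id.dist continuous_const).continuousAt.eventually
        (lt_mem_nhds (by simp only [id]; linarith))
    refine (continuousAt_const (y := (0 : ℝ))).congr ?_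
    filter_upwards [h] with z hz
    rw [tent_eq_zero hδ (by linarith), mul_zero]

section

variable {Y : Type*} [MetricSpace Y] [ProperSpace Y] [MeasurableSpace Y] [BorelSpace Y]

theorem ofReal_integral_tent {μ : Measure Y} [IsFiniteMeasureOnCompacts μ] (x : Y) (r : ℝ)
    {δ : ℝ} (hδ : 0 < δ) :
    ENNReal.ofReal (∫ y, tent x r δ y ∂μ) = ∫⁻ y, ENNReal.ofReal (tent x r δ y) ∂μ :=
  ofReal_integral_eq_lintegral_ofReal
    ((continuous_tent x r δ).integrable_of_hasCompactSupport (hasCompactSupport_tent hδ))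
    (ae_of_all _ (tent_nonneg x r δ))

theorem measure_closedBall_le_integral_tent {μ : Measure Y} [IsFiniteMeasureOnCompacts μ] (x : Y)
    (r : ℝ) {δ : ℝ} (hδ : 0 < δ) :
    μ (Metric.closedBall x r) ≤ ENNReal.ofReal (∫ y, tent x r δ y ∂μ) := by
  rw [ofReal_integral_tent x r hδ, ← lintegral_indicator_one Metric.isClosed_closedBall.measurableSet]
  refine lintegral_mono (indicator_le fun y hy => ?_)
  rw [tent_eq_one hδ hy]
  simp

theorem integral_tent_le_measure_ball {μ : Measure Y} [IsFiniteMeasureOnCompacts μ] (x : Y)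
    (r : ℝ) {δ : ℝ} (hδ : 0 < δ) :
    ENNReal.ofReal (∫ y, tent x r δ y ∂μ) ≤ μ (Metric.ball x (r + δ)) := by
  rw [ofReal_integral_tent x r hδ, ← lintegral_indicator_one measurableSet_ball]
  refine lintegral_mono fun y => ?_
  by_cases hy : y ∈ Metric.ball x (r + δ)
  · rw [indicator_of_mem hy]
    simpa using tent_le_one x r δ y
  · rw [indicator_of_notMem hy, tent_eq_zero hδ (by simpa [Metric.mem_ball] using hy)]
    simp

/-- The inner shells of a ball have small measure. -/
theorem exists_measure_ball_diff_ball_le (μ : Measure Y) [IsFiniteMeasureOnCompacts μ] (q : Y)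
    (r : ℝ) {η : ℝ} (hη : 0 < η) :
    ∃ δ > 0, μ (Metric.ball q r \ Metric.ball q (r - δ)) ≤ ENNReal.ofReal η := by
  let s : ℕ → Set Y := fun j => Metric.ball q r \ Metric.ball q (r - 1 / ((j : ℝ) + 1))
  have hanti : Antitone s := fun i j hij => by
    refine sdiff_subset_sdiff_right (Metric.ball_subset_ball ?_)
    have : 1 / ((j : ℝ) + 1) ≤ 1 / ((i : ℝ) + 1) := by gcongr
    linarith
  have hempty : ⋂ j, s j = ∅ := by
    refine eq_empty_of_forall_notMem fun y hy => ?_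
    rw [mem_iInter] at hy
    have h1 : dist y q < r := (hy 0).1
    obtain ⟨j, hj⟩ := exists_nat_one_div_lt (sub_pos.2 h1)
    refine (hy j).2 ?_
    rw [Metric.mem_ball]
    linarith
  have ht := tendsto_measure_iInter_atTop (μ := μ) (s := s)
    (fun j => (measurableSet_ball.diff measurableSet_ball).nullMeasurableSet) hanti
    ⟨0, ((measure_mono sdiff_subset).trans_lt measure_ball_lt_top).ne⟩
  rw [hempty, measure_empty] at ht
  obtain ⟨j, hj⟩ := (ht.eventually (ge_mem_nhds (ENNReal.ofReal_pos.2 hη))).exists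
  exact ⟨1 / ((j : ℝ) + 1), by positivity, hj⟩

/-- The integrands agree off the shell between radii `r - 2 * δ` and `r`, and differ there by at
most `M`. -/
theorem abs_setIntegral_sub_integral_mul_tent_le {μ : Measure Y} [IsFiniteMeasureOnCompacts μ]
    {φ : Y → ℝ} {q : Y} {r δ M η : ℝ} (hφ : ContinuousOn φ (Metric.ball q r)) (hδ : 0 < δ)
    (hM0 : 0 ≤ M) (hM : ∀ y ∈ Metric.ball q r, |φ y| ≤ M) (hη : 0 ≤ η)
    (hμ : μ (Metric.ball q r \ Metric.ball q (r - 2 * δ)) ≤ ENNReal.ofReal η) :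
    |∫ y in Metric.ball q r, φ y ∂μ - ∫ y, φ y * tent q (r - 2 * δ) δ y ∂μ| ≤ M * η := by
  have hfin : μ (Metric.ball q r) < ⊤ := measure_ball_lt_top
  have hint : IntegrableOn φ (Metric.ball q r) μ :=
    IntegrableOn.of_bound hfin (hφ.aestronglyMeasurable measurableSet_ball) M
      ((ae_restrict_iff' measurableSet_ball).2 (ae_of_all _ hM))
  have hsupp : HasCompactSupport fun y => φ y * tent q (r - 2 * δ) δ y :=
    (hasCompactSupport_tent hδ).mul_left
  rw [← setIntegral_eq_integral_of_forall_compl_eq_zero (s := Metric.ball q r)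
    (f := fun y => φ y * tent q (r - 2 * δ) δ y)
    (fun y hy => by
      rw [Metric.mem_ball, not_lt] at hy
      rw [tent_eq_zero hδ (by linarith), mul_zero]),
    ← integral_sub hint
      ((continuous_mul_tent hφ hδ).integrable_of_hasCompactSupport hsupp).integrableOn,
    setIntegral_eq_of_subset_of_forall_sdiff_eq_zero measurableSet_ball
      (sdiff_subset : Metric.ball q r \ Metric.ball q (r - 2 * δ) ⊆ _)
      (fun y hy => by
        have h : y ∈ Metric.ball q (r - 2 * δ) := by
          by_contra h
          exact hy.2 ⟨hy.1, h⟩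
        rw [tent_eq_one hδ (Metric.mem_ball.1 h).le, mul_one, sub_self]),
    ← Real.norm_eq_abs]
  refine (norm_setIntegral_le_of_norm_le_const (C := M) (hμ.trans_lt ENNReal.ofReal_lt_top)
    (fun y hy => ?_)).trans ?_
  · have h0 := tent_nonneg q (r - 2 * δ) δ y
    have h1 := tent_le_one q (r - 2 * δ) δ y
    rw [← mul_one_sub, norm_mul, Real.norm_eq_abs, Real.norm_eq_abs, 
      abs_of_nonneg (sub_nonneg.2 h1)]
    exact (mul_le_of_le_one_right (abs_nonneg _) (by linarith)).trans (hM y hy.1)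
  · exact mul_le_mul_of_nonneg_left (ENNReal.toReal_le_of_le_ofReal hη hμ) hM0

/-- Vague convergence implies weak convergence on a ball if no mass concentrates at its
boundary. -/
theorem tendstoWeaklyOn_ball {ν : ℕ → Measure Y} {μ : Measure Y}
    [∀ n, IsFiniteMeasureOnCompacts (ν n)] [IsFiniteMeasureOnCompacts μ]
    (hv : ∀ φ : Y → ℝ, Continuous φ → HasCompactSupport φ →
      Tendsto (fun n => ∫ y, φ y ∂(ν n)) atTop (𝓝 (∫ y, φ y ∂μ)))
    {q : Y} {r : ℝ} (hr : 0 < r)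
    (hs : ∀ η > 0, ∃ δ > 0, ∀ᶠ n in atTop,
      ν n (Metric.ball q r \ Metric.ball q (r - δ)) ≤ ENNReal.ofReal η) :
    TendstoWeaklyOn ν μ (Metric.ball q r) := by
  rintro φ hφu ⟨M, hM⟩
  have hφ := hφu.continuousOn
  have hM0 : 0 ≤ M := (abs_nonneg _).trans (hM q (Metric.mem_ball_self hr))
  refine Metric.tendsto_nhds.2 fun e he => ?_
  set η := e / (4 * (M + 1)) with hη
  have hη0 : 0 < η := by positivity
  have hMη : M * η ≤ e / 4 := by
    rw [hη, ← mul_div_assoc, div_le_div_iff₀ (by positivity) (by norm_num)]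
    nlinarith
  obtain ⟨δ₁, hδ₁, h₁⟩ := hs η hη0
  obtain ⟨δ₂, hδ₂, h₂⟩ := exists_measure_ball_diff_ball_le μ q r hη0
  set δ := min δ₁ δ₂ / 2 with hδ
  have hδ0 : 0 < δ := by positivity
  have hsub₁ : Metric.ball q r \ Metric.ball q (r - 2 * δ) ⊆
      Metric.ball q r \ Metric.ball q (r - δ₁) :=
    sdiff_subset_sdiff_right (Metric.ball_subset_ball (by linarith [min_le_left δ₁ δ₂]))
  have hsub₂ : Metric.ball q r \ Metric.ball q (r - 2 * δ) ⊆
      Metric.ball q r \ Metric.ball q (r - δ₂) :=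
    sdiff_subset_sdiff_right (Metric.ball_subset_ball (by linarith [min_le_right δ₁ δ₂]))
  have hlim := hv _ (continuous_mul_tent hφ hδ0) (hasCompactSupport_tent hδ0).mul_left
  have h4 := abs_le.1 (abs_setIntegral_sub_integral_mul_tent_le hφ hδ0 hM0 hM hη0.le
    ((measure_mono hsub₂).trans h₂))
  filter_upwards [h₁, Metric.tendsto_nhds.1 hlim (e / 4) (by positivity)] with n hn1 hn2
  have h3 := abs_le.1 (abs_setIntegral_sub_integral_mul_tent_le hφ hδ0 hM0 hM hη0.le
    ((measure_mono hsub₁).trans hn1))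
  rw [Real.dist_eq] at hn2 ⊢
  have h5 := abs_lt.1 hn2
  rw [abs_lt]
  constructor <;> linarith [h3.1, h3.2, h4.1, h4.2, h5.1, h5.2]

end

/-! ### Balls under approximate isometries -/

namespace IsApproxIsometryFamily

variable {X : ℕ → Type*} [∀ n, MetricSpace (X n)] [∀ n, MeasurableSpace (X n)]
  {m : ∀ n, Measure (X n)} {p : ∀ n, X n} {Y : Type*} [MetricSpace Y] [MeasurableSpace Y] {q : Y}
  {ε R : ℕ → ℝ} {f : ∀ n, X n → Y}

theorem eventually_eps_le (hf : IsApproxIsometryFamily X m p Y q ε R f) {δ : ℝ} (hδ : 0 < δ) :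
    ∀ᶠ n in atTop, ε n ≤ δ :=
  hf.eps_tendsto.eventually (ge_mem_nhds hδ)

/-- The image of `f n` is a finite `2 * ε n`-net once `R n ≥ r`. -/
theorem totallyBounded_ball (hf : IsApproxIsometryFamily X m p Y q ε R f) (r : ℝ) :
    TotallyBounded (Metric.ball q r) := by
  refine Metric.totallyBounded_iff.2 fun e he => ?_
  obtain ⟨n, hn1, hn2⟩ := ((hf.eventually_eps_le (δ := e / 3) (by positivity)).and
    (hf.R_tendsto.eventually_ge_atTop r)).exists
  refine ⟨_, hf.finite_image n, fun y hy => ?_⟩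
  obtain ⟨x, hx, hxy⟩ := hf.net n y (Metric.ball_subset_ball hn2 hy)
  exact mem_iUnion₂.2 ⟨f n x, mem_image_of_mem _ hx, by rw [Metric.mem_ball]; linarith⟩

theorem properSpace [CompleteSpace Y] (hf : IsApproxIsometryFamily X m p Y q ε R f) :
    ProperSpace Y where
  isCompact_closedBall x r := by
    obtain ⟨s, hs⟩ := (Metric.isBounded_closedBall (x := x) (r := r)).subset_ball q
    exact ((hf.totallyBounded_ball s).subset hs).isCompact_of_isClosed Metric.isClosed_closedBall

theorem map_apply [∀ n, OpensMeasurableSpace (X n)]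
    (hf : IsApproxIsometryFamily X m p Y q ε R f) (n : ℕ) {A : Set Y} (hA : MeasurableSet A) :
    ((m n).restrict (Metric.closedBall (p n) (R n))).map (f n) A =
      m n (f n ⁻¹' A ∩ Metric.closedBall (p n) (R n)) := by
  rw [Measure.map_apply_of_aemeasurable (hf.aemeasurable n) hA,
    Measure.restrict_apply' Metric.isClosed_closedBall.measurableSet]

theorem mem_closedBall_basepoint (hf : IsApproxIsometryFamily X m p Y q ε R f) (n : ℕ) :
    p n ∈ Metric.closedBall (p n) (R n) :=
  Metric.mem_closedBall_self (hf.R_pos n).le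

theorem abs_dist_basepoint_le (hf : IsApproxIsometryFamily X m p Y q ε R f) {n : ℕ} {x : X n}
    (hx : x ∈ Metric.closedBall (p n) (R n)) : |dist (f n x) q - dist x (p n)| ≤ ε n := by
  simpa only [hf.basepoint n] using hf.distortion n x hx _ (hf.mem_closedBall_basepoint n)

/-- A radius below the diameter of the limit is, with some room, below the diameters of the
spaces. -/
theorem eventually_lt_ediam (hf : IsApproxIsometryFamily X m p Y q ε R f) {r s : ℝ} (hs : 0 < s)
    (hsr : s < r) (hr : ENNReal.ofReal r < Metric.ediam (univ : Set Y)) :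
    ∀ᶠ n in atTop, ENNReal.ofReal s < Metric.ediam (univ : Set (X n)) := by
  obtain ⟨y, -, z, -, hyz⟩ : ∃ y ∈ (univ : Set Y), ∃ z ∈ (univ : Set Y),
      ENNReal.ofReal r < edist y z := by
    by_contra! h
    exact absurd (Metric.ediam_le h) (not_le.2 hr)
  rw [edist_dist, ENNReal.ofReal_lt_ofReal_iff_of_nonneg (by linarith)] at hyz
  -- Replacing `y` and `z` by net points costs `2 * ε n` each, and the distortion costs `ε n`.
  filter_upwards [hf.eventually_eps_le (δ := (r - s) / 5) (by linarith),
    hf.R_tendsto.eventually_gt_atTop (dist y q), hf.R_tendsto.eventually_gt_atTop (dist z q)]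
    with n hn1 hn2 hn3
  obtain ⟨a, ha, hya⟩ := hf.net n y hn2
  obtain ⟨b, hb, hzb⟩ := hf.net n z hn3
  refine lt_of_lt_of_le ?_ (Metric.edist_le_ediam_of_mem (mem_univ a) (mem_univ b))
  have h1 := (abs_le.1 (hf.distortion n a ha b hb)).2
  have h2 := dist_triangle4 y (f n a) (f n b) z
  rw [dist_comm (f n b)] at h2
  rw [edist_dist, ENNReal.ofReal_lt_ofReal_iff_of_nonneg hs.le]
  linarith

variable [∀ n, OpensMeasurableSpace (X n)] [OpensMeasurableSpace Y]

theorem map_closedBall_basepoint_le (hf : IsApproxIsometryFamily X m p Y q ε R f) (n : ℕ)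
    {r s : ℝ} (hrs : r + ε n < s) :
    ((m n).restrict (Metric.closedBall (p n) (R n))).map (f n) (Metric.closedBall q r) ≤
      m n (Metric.ball (p n) s) := by
  rw [hf.map_apply n Metric.isClosed_closedBall.measurableSet]
  refine measure_mono ?_
  rintro x ⟨hx1, hx2⟩
  have h1 := (abs_le.1 (hf.abs_dist_basepoint_le hx2)).1
  have h2 : dist (f n x) q ≤ r := hx1
  rw [Metric.mem_ball]
  linarith

theorem exists_map_ball_le (hf : IsApproxIsometryFamily X m p Y q ε R f) (n : ℕ) {y : Y}
    (hy : dist y q < R n) (r : ℝ) :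
    ∃ x, ((m n).restrict (Metric.closedBall (p n) (R n))).map (f n) (Metric.ball y r) ≤
      m n (Metric.ball x (r + 3 * ε n)) := by
  obtain ⟨x, hx, hxy⟩ := hf.net n y hy
  refine ⟨x, ?_⟩
  rw [hf.map_apply n measurableSet_ball]
  refine measure_mono ?_
  rintro z ⟨hz1, hz2⟩
  have h1 := (abs_le.1 (hf.distortion n z hz2 x hx)).1
  have h2 : dist (f n z) y < r := hz1
  have h3 := dist_triangle (f n z) y (f n x)
  rw [Metric.mem_ball]
  linarith

/-- The room below `R n` keeps the whole ball around `x` in the region where `f n` is controlled. -/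
theorem exists_ball_le_map (hf : IsApproxIsometryFamily X m p Y q ε R f) (n : ℕ) {y : Y}
    {r : ℝ} (hr : 0 ≤ r) (hy : dist y q + r + 3 * ε n < R n) :
    ∃ x, m n (Metric.ball x r) ≤
      ((m n).restrict (Metric.closedBall (p n) (R n))).map (f n)
        (Metric.closedBall y (r + 3 * ε n)) := by
  have hε := hf.eps_pos n
  obtain ⟨x, hx, hxy⟩ := hf.net n y (by rw [Metric.mem_ball]; linarith)
  refine ⟨x, ?_⟩
  rw [hf.map_apply n Metric.isClosed_closedBall.measurableSet]
  refine measure_mono fun z hz => ?_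
  rw [Metric.mem_ball] at hz
  have h0 := (abs_le.1 (hf.abs_dist_basepoint_le hx)).1
  have h4 := dist_triangle_left (f n x) q y
  have h5 := dist_triangle z x (p n)
  have hz2 : z ∈ Metric.closedBall (p n) (R n) := by
    rw [Metric.mem_closedBall]
    linarith
  refine ⟨?_, hz2⟩
  have h1 := (abs_le.1 (hf.distortion n z hz2 x hx)).2
  have h3 := dist_triangle_right (f n z) y (f n x)
  rw [mem_preimage, Metric.mem_closedBall]
  linarith

end IsApproxIsometryFamily

/-! ### Uniform bounds for the push-forward measures and their limits -/

/-- The constant in the upper volume bound for balls of arbitrary radii. -/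
noncomputable def ballConstant (C α' : ℝ) : ℝ := (1 + coveringConstant C α').toReal

theorem ofReal_ballConstant (C α' : ℝ) :
    ENNReal.ofReal (ballConstant C α') = 1 + coveringConstant C α' :=
  ENNReal.ofReal_toReal (ENNReal.add_ne_top.2 ⟨ENNReal.one_ne_top, coveringConstant_ne_top C α'⟩)

theorem one_le_ballConstant (C α' : ℝ) : 1 ≤ ballConstant C α' := by
  rw [← ENNReal.one_le_ofReal, ofReal_ballConstant]
  exact le_self_add

section

variable {X : ℕ → Type*} [∀ n, MetricSpace (X n)] [∀ n, MeasurableSpace (X n)]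
  [∀ n, BorelSpace (X n)] {m : ∀ n, Measure (X n)}
  {V : ℕ → ℝ → ℝ} {Vinf Vl Vu : ℝ → ℝ} {C α α' : ℝ}

variable {p : ∀ n, X n} {Y : Type*} [MetricSpace Y] [MeasurableSpace Y] [BorelSpace Y] {q : Y}
  {ε R : ℕ → ℝ} {f : ∀ n, X n → Y}

/-- Dropping to radius `r / 4` in `X n` keeps it below the diameter there; the target radius `r / 2`
leaves room for a tent supported in the ball of radius `r`. -/
theorem IsApproxIsometryFamily.eventually_le_map_closedBall (hf : IsApproxIsometryFamily X m p Y q ε R f)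
    (h : UniformVolumeAssumption X m V Vinf Vl Vu C α α')
    (y : Y) {r : ℝ} (hr : 0 < r) (hrd : ENNReal.ofReal r < Metric.ediam (univ : Set Y)) :
    ∀ᶠ n in atTop, ENNReal.ofReal ((C * (C * 4 ^ α'))⁻¹ * V n r) ≤
      ((m n).restrict (Metric.closedBall (p n) (R n))).map (f n) (Metric.closedBall y (r / 2)) := by
  filter_upwards [hf.eventually_eps_le (δ := r / 12) (by positivity),
    hf.R_tendsto.eventually_gt_atTop (dist y q + r / 2),
    hf.eventually_lt_ediam (s := r / 4) (by linarith) (by linarith) hrd] with n hn1 hn2 hn3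
  obtain ⟨x, hx⟩ := hf.exists_ball_le_map n (y := y) (r := r / 4) (by linarith) (by linarith)
  refine le_trans ?_ (hx.trans (measure_mono (Metric.closedBall_subset_closedBall (by linarith))))
  refine le_trans (ENNReal.ofReal_le_ofReal ?_) (h.volume n x (r / 4) (by linarith) hn3).1
  have h2 := h.one_le_C
  have h3 := (h.growth n).mul_le (h.gauge n) (r := r / 4) (t := 4) (by linarith) (by norm_num)
  rw [mul_div_cancel₀ r (by norm_num : (4 : ℝ) ≠ 0)] at h3
  calc (C * (C * 4 ^ α'))⁻¹ * V n r
      ≤ (C * (C * 4 ^ α'))⁻¹ * (C * 4 ^ α' * V n (r / 4)) := by gcongr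
    _ = C⁻¹ * V n (r / 4) := by field_simp

variable [∀ n, ProperSpace (X n)]

theorem UniformVolumeAssumption.ball_le (h : UniformVolumeAssumption X m V Vinf Vl Vu C α α')
    (hlen : ∀ n, IsLengthSpace (X n)) (n : ℕ) [Nontrivial (X n)] (x : X n) {r : ℝ} (hr : 0 < r) :
    m n (Metric.ball x r) ≤ ENNReal.ofReal (ballConstant C α' * (C * V n r)) := by
  rw [ENNReal.ofReal_mul (zero_le_one.trans (one_le_ballConstant C α')), ofReal_ballConstant]
  exact (h.volume n).ball_le h.one_le_C (h.gauge n) (h.growth n) (hlen n) x hr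

theorem UniformVolumeAssumption.ball_le_uniform
    (h : UniformVolumeAssumption X m V Vinf Vl Vu C α α')
    (hlen : ∀ n, IsLengthSpace (X n)) (n : ℕ) [Nontrivial (X n)] (x : X n) {r : ℝ} (hr : 0 < r) :
    m n (Metric.ball x r) ≤ ENNReal.ofReal (ballConstant C α' * (C * (C * Vu r))) := by
  refine (h.ball_le hlen n x hr).trans (ENNReal.ofReal_le_ofReal ?_)
  have h1 := one_le_ballConstant C α'
  have h2 := h.one_le_C
  have h3 := (h.bounds n r hr).2
  gcongr

namespace IsApproxIsometryFamily

theorem map_closedBall_basepoint_le_uniform (hf : IsApproxIsometryFamily X m p Y q ε R f)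
    (h : UniformVolumeAssumption X m V Vinf Vl Vu C α α') (hlen : ∀ n, IsLengthSpace (X n))
    (n : ℕ) [Nontrivial (X n)] (r : ℝ) :
    ((m n).restrict (Metric.closedBall (p n) (R n))).map (f n) (Metric.closedBall q r) ≤
      ENNReal.ofReal (ballConstant C α' * (C * (C * Vu (|r| + ε 0 + 1)))) := by
  have h1 := hf.eps_antitone (Nat.zero_le n)
  have h2 := hf.eps_pos 0
  exact (hf.map_closedBall_basepoint_le n (s := |r| + ε 0 + 1) (by linarith [le_abs_self r])).trans
    (h.ball_le_uniform hlen n _ (by positivity))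

/-- Once `ε n ≤ δ`, the preimage of the shell lies in an annulus of half-width `2 * δ`, where the
geometric decay applies with a mass bound independent of `n`. -/
theorem exists_map_ball_diff_ball_le (hf : IsApproxIsometryFamily X m p Y q ε R f)
    (h : UniformVolumeAssumption X m V Vinf Vl Vu C α α') (hlen : ∀ n, IsLengthSpace (X n))
    {r η : ℝ} (hr : 0 < r) (hη : 0 < η) :
    ∃ δ > 0, ∀ᶠ n in atTop, Nontrivial (X n) →
      ((m n).restrict (Metric.closedBall (p n) (R n))).map (f n)
        (Metric.ball q r \ Metric.ball q (r - δ)) ≤ ENNReal.ofReal η := by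
  have ht : Tendsto (fun j : ℕ => (coveringConstant C α' / (1 + coveringConstant C α')) ^ j *
      ENNReal.ofReal (ballConstant C α' * (C * (C * Vu (2 * r))))) atTop (𝓝 0) := by
    simpa using ENNReal.Tendsto.mul_const
      (ENNReal.tendsto_pow_atTop_nhds_zero_of_lt_one (coveringConstant_div_lt_one C α'))
      (Or.inr ENNReal.ofReal_ne_top)
  obtain ⟨j, hj⟩ := (ht.eventually (ge_mem_nhds (ENNReal.ofReal_pos.2 hη))).exists
  set δ := r / 50 / 9 ^ j / 2 with hδ
  have hδ0 : 0 < δ := by positivity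
  refine ⟨δ, hδ0, ?_⟩
  filter_upwards [hf.eventually_eps_le hδ0] with n hn hnt
  rw [hf.map_apply n (measurableSet_ball.diff measurableSet_ball)]
  calc _ ≤ m n {x | |dist x (p n) - r| ≤ r / 50 / 9 ^ j} := by
        refine measure_mono ?_
        rintro x ⟨⟨hx1, hx2⟩, hx3⟩
        have h1 := abs_le.1 (hf.abs_dist_basepoint_le hx3)
        rw [Metric.mem_ball] at hx1 hx2
        rw [mem_ofPred_eq, abs_le]
        constructor <;> linarith [h1.1, h1.2]
    _ ≤ _ := (h.volume n).annulus_le_pow h.one_le_C (h.gauge n) (h.growth n) (hlen n) (p n) hr j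
    _ ≤ _ := by
        gcongr
        exact h.ball_le_uniform hlen n _ (by linarith)
    _ ≤ _ := hj

theorem eventually_map_ball_le (hf : IsApproxIsometryFamily X m p Y q ε R f)
    (h : UniformVolumeAssumption X m V Vinf Vl Vu C α α') (hlen : ∀ n, IsLengthSpace (X n))
    (y : Y) {r : ℝ} (hr : 0 < r) :
    ∀ᶠ n in atTop, Nontrivial (X n) →
      ((m n).restrict (Metric.closedBall (p n) (R n))).map (f n) (Metric.ball y (r + r / 2)) ≤
        ENNReal.ofReal (ballConstant C α' * (C * (C * 2 ^ α')) * V n r) := by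
  filter_upwards [hf.eventually_eps_le (δ := r / 6) (by positivity),
    hf.R_tendsto.eventually_gt_atTop (dist y q)] with n hn1 hn2 hnt
  obtain ⟨x, hx⟩ := hf.exists_map_ball_le n hn2 (r + r / 2)
  refine hx.trans ((measure_mono (Metric.ball_subset_ball (by linarith))).trans
    ((h.ball_le hlen n x (r := 2 * r) (by linarith)).trans (ENNReal.ofReal_le_ofReal ?_)))
  have h1 := one_le_ballConstant C α'
  have h2 := h.one_le_C
  have h3 := (h.growth n).mul_le (h.gauge n) hr (t := 2) (by norm_num)
  calc _ ≤ ballConstant C α' * (C * (C * 2 ^ α' * V n r)) := by gcongr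
    _ = _ := by ring

/-- Vague limits of the push-forward measures inherit the volume growth. -/
theorem hasVolumeGrowth_of_tendsto [ProperSpace Y]
    (hf : IsApproxIsometryFamily X m p Y q ε R f)
    (h : UniformVolumeAssumption X m V Vinf Vl Vu C α α') (hlen : ∀ n, IsLengthSpace (X n))
    (hV : ∀ r, 0 < r → Tendsto (fun n => V n r) atTop (𝓝 (Vinf r)))
    {k : ℕ → ℕ} (hk : StrictMono k) (hkn : ∀ i, Nontrivial (X (k i)))
    {μ : Measure Y} [IsFiniteMeasureOnCompacts μ]
    [∀ i, IsFiniteMeasureOnCompacts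
      (((m (k i)).restrict (Metric.closedBall (p (k i)) (R (k i)))).map (f (k i)))]
    (hv : ∀ φ : Y → ℝ, Continuous φ → HasCompactSupport φ →
      Tendsto (fun i => ∫ y, φ y
        ∂(((m (k i)).restrict (Metric.closedBall (p (k i)) (R (k i)))).map (f (k i))))
        atTop (𝓝 (∫ y, φ y ∂μ))) :
    HasVolumeGrowth μ Vinf (ballConstant C α' * (C * (C * 4 ^ α'))) := by
  have hκ := one_le_ballConstant C α'
  have hC := h.one_le_C
  have hα' := h.alpha'_pos
  have hD : 0 < C * (C * 4 ^ α') := by positivity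
  have hlim : ∀ c : ℝ, ∀ r, 0 < r →
      Tendsto (fun i => ENNReal.ofReal (c * V (k i) r)) atTop (𝓝 (ENNReal.ofReal (c * Vinf r))) :=
    fun c r hr => ENNReal.tendsto_ofReal (((hV r hr).comp hk.tendsto_atTop).const_mul c)
  intro y r hr hrd
  have hVr := h.gauge_inf.pos r hr
  constructor
  · have h1 : ENNReal.ofReal ((C * (C * 4 ^ α'))⁻¹ * Vinf r) ≤
        ENNReal.ofReal (∫ z, tent y (r / 2) (r / 2) z ∂μ) := by
      refine le_of_tendsto_of_tendsto (hlim _ r hr) (ENNReal.tendsto_ofReal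
        (hv _ (continuous_tent _ _ _) (hasCompactSupport_tent (by positivity)))) ?_
      filter_upwards [hk.tendsto_atTop.eventually (hf.eventually_le_map_closedBall h y hr hrd)]
        with i hi
      exact hi.trans (measure_closedBall_le_integral_tent y _ (by positivity))
    have h2 := h1.trans (integral_tent_le_measure_ball y (r / 2) (by positivity))
    rw [add_halves] at h2
    refine le_trans (ENNReal.ofReal_le_ofReal ?_) h2
    exact mul_le_mul_of_nonneg_right (inv_anti₀ hD (le_mul_of_one_le_left hD.le hκ)) hVr.le
  · refine (measure_mono Metric.ball_subset_closedBall).trans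
      ((measure_closedBall_le_integral_tent y r (δ := r / 2) (by positivity)).trans ?_)
    have h1 : ENNReal.ofReal (∫ z, tent y r (r / 2) z ∂μ) ≤
        ENNReal.ofReal (ballConstant C α' * (C * (C * 2 ^ α')) * Vinf r) := by
      refine le_of_tendsto_of_tendsto (ENNReal.tendsto_ofReal
        (hv _ (continuous_tent _ _ _) (hasCompactSupport_tent (by positivity)))) (hlim _ r hr) ?_
      filter_upwards [hk.tendsto_atTop.eventually (hf.eventually_map_ball_le h hlen y hr)]
        with i hi
      exact (integral_tent_le_measure_ball y r (by positivity)).trans (hi (hkn i))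
    refine h1.trans (ENNReal.ofReal_le_ofReal ?_)
    gcongr
    norm_num

end IsApproxIsometryFamily

end

/-! ### The limit measure -/

theorem proposition3p2
    (X : ℕ → Type*) [∀ n, MetricSpace (X n)] [∀ n, ProperSpace (X n)]
    [∀ n, MeasurableSpace (X n)] [∀ n, BorelSpace (X n)]
    (hlen : ∀ n, IsLengthSpace (X n))
    (hpts : ∃ᶠ n in atTop, Nontrivial (X n))
    (m : ∀ n, Measure (X n)) (hm : ∀ n, (m n).Regular)
    (Xinf : Type*) [MetricSpace Xinf] [CompleteSpace Xinf]
    [MeasurableSpace Xinf] [BorelSpace Xinf]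
    (p : ∀ n, X n) (pinf : Xinf)
    (V : ℕ → ℝ → ℝ) (Vinf Vl Vu : ℝ → ℝ) (Cv α α' : ℝ)
    (hvol : UniformVolumeAssumption X m V Vinf Vl Vu Cv α α')
    (hV : VolumeTendsto V Vinf)
    (hGH : PointedGHTendsto X p Xinf pinf) :
    (∃ (ε R : ℕ → ℝ) (f : ∀ n, X n → Xinf),
      IsApproxIsometryFamily X m p Xinf pinf ε R f) ∧
    ∀ (ε R : ℕ → ℝ) (f : ∀ n, X n → Xinf),
      IsApproxIsometryFamily X m p Xinf pinf ε R f →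
      ∃ minf : Measure Xinf, minf.Regular ∧
        (∃ C : ℝ, 1 ≤ C ∧ HasVolumeGrowth minf Vinf C) ∧
        ∃ k : ℕ → ℕ, StrictMono k ∧
          ∀ r : ℝ, (0 < r ∧ r ∈ range ((↑) : ℚ → ℝ)) ∨ r ∈ range R →
            TendstoWeaklyOn
              (fun i => ((m (k i)).restrict
                (Metric.closedBall (p (k i)) (R (k i)))).map (f (k i)))
              minf (Metric.ball pinf r) := by
  refine ⟨hGH.exists_isApproxIsometryFamily hlen m, fun ε R f hf => ?_⟩
  have := hf.properSpace
  -- On a one-point space the volume assumption is vacuous, so mass bounds are available only along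
  -- the nontrivial spaces.
  obtain ⟨k₁, hk₁, hnt⟩ := extraction_of_frequently_atTop hpts
  have hC := hvol.one_le_C
  have hκ := one_le_ballConstant Cv α'
  have hmass := fun r i => hf.map_closedBall_basepoint_le_uniform hvol hlen (k₁ i) r
  obtain ⟨k₂, hk₂, minf, hreg, hv⟩ := exists_subseq_tendsto_integral pinf
    (fun i => ((m (k₁ i)).restrict (Metric.closedBall (p (k₁ i)) (R (k₁ i)))).map (f (k₁ i)))
    (fun r => by
      have h1 := hf.eps_pos 0
      have h2 := hvol.gauge_u.pos (|r| + ε 0 + 1) (by positivity)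
      positivity) hmass
  have hk : StrictMono fun i => k₁ (k₂ i) := hk₁.comp hk₂
  have hfin : ∀ i, IsFiniteMeasureOnCompacts (((m (k₁ (k₂ i))).restrict
      (Metric.closedBall (p (k₁ (k₂ i))) (R (k₁ (k₂ i))))).map (f (k₁ (k₂ i)))) := fun i =>
    isFiniteMeasureOnCompacts_of_closedBall pinf fun r =>
      (hmass r (k₂ i)).trans_lt ENNReal.ofReal_lt_top
  have hVr : ∀ r, 0 < r → Tendsto (fun n => V n r) atTop (𝓝 (Vinf r)) := fun r hr =>
    (hV {r} (singleton_subset_iff.2 hr) isCompact_singleton).tendsto_at rfl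
  refine ⟨minf, hreg, ⟨_, ?_, hf.hasVolumeGrowth_of_tendsto hvol hlen hVr hk
    (fun i => hnt (k₂ i)) hv⟩, fun i => k₁ (k₂ i), hk, fun r hr => ?_⟩
  · have h4 : (1 : ℝ) ≤ 4 ^ α' := Real.one_le_rpow (by norm_num) hvol.alpha'_pos.le
    exact one_le_mul_of_one_le_of_one_le hκ
      (one_le_mul_of_one_le_of_one_le hC (one_le_mul_of_one_le_of_one_le hC h4))
  · have hr0 : 0 < r := by
      rcases hr with hr | ⟨n, rfl⟩
      · exact hr.1
      · exact hf.R_pos n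
    refine tendstoWeaklyOn_ball hv hr0 fun η hη => ?_
    obtain ⟨δ, hδ, h⟩ := hf.exists_map_ball_diff_ball_le hvol hlen hr0 hη
    exact ⟨δ, hδ, (hk.tendsto_atTop.eventually h).mono fun i hi => hi (hnt (k₂ i))⟩
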